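/- Let $\mathcal L_n$ ($n\ge1$) be the set of simple graphs on $[n]=\{1,\dots,n\}$, $\mathcal L=\bigcup_{n\ge1}\mathcal L_n$, and let $\mathcal U=\mathcal L/\!\cong$ be the set of unlabelled finite graphs; write $v(G)$ for the number of vertices of $G$. For graphs $F,G$ let $t(F,G)$ be the proportion of all maps $V(F)\to V(G)$ that are graph homomorphisms, and let $t_{\mathrm{ind}}(F,G)$ be the proportion of all injective maps $V(F)\to V(G)$ that preserve both adjacency and non-adjacency ($0$ if $v(F)>v(G)$). Put $\tau(G)=(t(F,G))_{F\in\mathcal U}\in[0,1]^{\mathcal U}$ and $\tau^+(G)=(\tau(G),1/v(G))\in[0,1]^{\mathcal U}\times[0,1]$, with product topologies. The map $\tau^+$ is injective; identify $\mathcal U$ with $\tau^+(\mathcal U)$, let $\overline{\mathcal U}=\overline{\tau^+(\mathcal U)}$ be its closure and $\mathcal U_\infty=\overline{\mathcal U}\setminus\mathcal U$ the set of proper graph limits. The functions $t(F,\cdot)$ and $t_{\mathrm{ind}}(F,\cdot)$ on $\mathcal U$ are extended to $\overline{\mathcal U}$ by continuity. A random infinite graph $H$ on the vertex set $\mathbb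 N$ (a random element of $\{0,1\}^{E(K_\infty)}$) is exchangeable if its distribution is invariant under all permutations of $\mathbb N$; $H|_n$ denotes the induced subgraph on the first $n$ vertices, and, for $F\in\mathcal L$, $H\supseteq F$ means $E(F)\subseteq E(H)$. **Theorem.** The projection $[0,1]^{\mathcal U}\times[0,1]\to[0,1]^{\mathcal U}$ restricts to a homeomorphism of $\mathcal U_\infty$ onto $\overline{\tau(\mathcal U)}$. There is a bijection between (Borel probability) distributions of random elements $\Gamma$ of $\mathcal U_\infty$ and distributions of exchangeable random infinite graphs $H$ on $\mathbb N$, such that the distributions of $\Gamma$ and $H$ correspond to each other if and only if $$\mathbb E\,t_{\mathrm{ind}}(F,\Gamma)=\mathbb P(H|_k=F)\qquad\text{for every }k\ge1\text{ and every }F\in\mathcal L_k,$$ or, equivalently, if and only if $$\mathbb E\,t(F,\Gamma)=\mathbb P(H\supseteq F)\qquad\text{for every }F\in\mathcal L.$$ Furthermore, for corresponding $\Gamma$ and $H$, $H|_n$ (as an unlabelled graph) converges in distribution to $\Gamma$ in $\overline{\mathcal U}$ as $n\to\infty$. The same holds with $\mathcal U_\infty$ replaced by $\overline{\tau(\mathcal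 U)}$, whose elements are identified with those of $\mathcal U_\infty$ through the above homeomorphism. -/

import Mathlib

open MeasureTheory ProbabilityTheory Filter Topology unitInterval

noncomputable section

namespace GraphLimit

/-- Finite labelled graphs: simple graphs on `n ≥ 1` labelled vertices (the labels `1, …, n` are
represented by the elements `0, …, n - 1` of `Fin n`). -/
abbrev LGraph : Type := Σ n : ℕ+, SimpleGraph (Fin n)

/-- Isomorphism of finite labelled graphs. -/
instance lgraphSetoid : Setoid LGraph where
  r F G := Nonempty (F.2 ≃g G.2)
  iseqv :=
    { refl := fun _ => ⟨RelIso.refl _⟩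
      symm := fun ⟨e⟩ => ⟨e.symm⟩
      trans := fun ⟨e⟩ ⟨f⟩ => ⟨e.trans f⟩ }

/-- Finite unlabelled graphs: isomorphism classes of finite labelled graphs. -/
abbrev UGraph : Type := Quotient lgraphSetoid

/-- The unlabelled graph underlying a labelled graph on `n` vertices. -/
def toU {n : ℕ+} (F : SimpleGraph (Fin n)) : UGraph := Quotient.mk lgraphSetoid ⟨n, F⟩

lemma card_eq_of_iso {F G : LGraph} (h : F ≈ G) : F.1 = G.1 := by
  obtain ⟨e⟩ := h
  have := Fintype.card_congr e.toEquiv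
  simpa using this

/-- The number of vertices of an unlabelled graph. -/
def UGraph.v (G : UGraph) : ℕ+ := Quotient.lift (fun F : LGraph => F.1) (fun _ _ => card_eq_of_iso) G

/-- Labelled version of the homomorphism density: the proportion of all maps `V(F) → V(G)` that are
graph homomorphisms. -/
def tL (F G : LGraph) : ℝ := Nat.card (F.2 →g G.2) / Nat.card (Fin F.1 → Fin G.1)

/-- Labelled version of the induced density: the proportion of all injective maps `V(F) → V(G)` that
preserve both adjacency and non-adjacency. If `v(F) > v(G)` there is no injective map, and the value
is `0 / 0 = 0`, as it should be by convention. -/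
def tindL (F G : LGraph) : ℝ := Nat.card (F.2 ↪g G.2) / Nat.card (Fin F.1 ↪ Fin G.1)

lemma tL_congr (F G F' G' : LGraph) (hF : F ≈ F') (hG : G ≈ G') : tL F G = tL F' G' := by
  have h1 := card_eq_of_iso hF
  have h2 := card_eq_of_iso hG
  obtain ⟨e⟩ := hF
  obtain ⟨f⟩ := hG
  have h3 : Nat.card (F.2 →g G.2) = Nat.card (F'.2 →g G'.2) := Nat.card_congr
    { toFun := fun φ => (f.toHom.comp φ).comp e.symm.toHom
      invFun := fun φ => (f.symm.toHom.comp φ).comp e.toHom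
      left_inv := fun φ => by ext x; simp
      right_inv := fun φ => by ext x; simp }
  rw [tL, tL, h3, h1, h2]

lemma tindL_congr (F G F' G' : LGraph) (hF : F ≈ F') (hG : G ≈ G') : tindL F G = tindL F' G' := by
  have h1 := card_eq_of_iso hF
  have h2 := card_eq_of_iso hG
  obtain ⟨e⟩ := hF
  obtain ⟨f⟩ := hG
  have h3 : Nat.card (F.2 ↪g G.2) = Nat.card (F'.2 ↪g G'.2) := Nat.card_congr
    { toFun := fun φ => (f.toEmbedding.comp φ).comp e.symm.toEmbedding
      invFun := fun φ => (f.symm.toEmbedding.comp φ).comp e.toEmbedding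
      left_inv := fun φ => by ext x; simp
      right_inv := fun φ => by ext x; simp }
  rw [tindL, tindL, h3, h1, h2]

/-- The homomorphism density `t(F, G)` of unlabelled graphs. -/
def t (F G : UGraph) : ℝ := Quotient.lift₂ tL tL_congr F G

/-- The induced density `t_ind(F, G)` of unlabelled graphs. -/
def tind (F G : UGraph) : ℝ := Quotient.lift₂ tindL tindL_congr F G

lemma t_mem (F G : UGraph) : t F G ∈ I := by
  induction F, G using Quotient.inductionOn₂ with
  | h F G =>
    change tL F G ∈ I
    refine ⟨by unfold tL; positivity, ?_⟩
    refine div_le_one_of_le₀ ?_ (by positivity)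
    exact_mod_cast Nat.card_le_card_of_injective (fun φ : F.2 →g G.2 => (φ : Fin F.1 → Fin G.1))
      DFunLike.coe_injective

lemma inv_v_mem (G : UGraph) : ((G.v : ℕ) : ℝ)⁻¹ ∈ I :=
  ⟨by positivity, inv_le_one_of_one_le₀ (by exact_mod_cast (one_le : 1 ≤ G.v))⟩

/-- The map `τ(G) = (t(F, G))_F` from unlabelled graphs to the cube `[0,1]^U`. -/
def tau (G : UGraph) : UGraph → I := fun F => ⟨t F G, t_mem F G⟩

/-- The map `τ⁺(G) = (τ(G), 1 / v(G))` from unlabelled graphs to `[0,1]^U × [0,1]`. -/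
def tauPlus (G : UGraph) : (UGraph → I) × I := (tau G, ⟨((G.v : ℕ) : ℝ)⁻¹, inv_v_mem G⟩)

/-- The closure of `τ(U)` in `[0,1]^U`. -/
def UstarBar : Set (UGraph → I) := closure (Set.range tau)

/-- The compactification `Ū` of the set of unlabelled graphs: the closure of `τ⁺(U)`. -/
def Ubar : Set ((UGraph → I) × I) := closure (Set.range tauPlus)

/-- The set `U_∞ = Ū \ U` of proper graph limits. -/
def Uinf : Set ((UGraph → I) × I) := Ubar \ Set.range tauPlus

/-- An unlabelled graph seen as an element of `Ū`. -/
def toBar (G : UGraph) : Ubar := ⟨tauPlus G, subset_closure ⟨G, rfl⟩⟩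

/-- A proper graph limit seen as an element of `Ū`. -/
def infToBar : Uinf → Ubar := Set.inclusion Set.sdiff_subset

/-- The continuous extension of `t(F, ·)` to `Ū`, which is a coordinate function. -/
def tBar (F : UGraph) (x : Ubar) : ℝ := x.1.1 F

/-- The continuous extension of `t_ind(F, ·)` to `Ū`: its value at `x` is the limit of `t_ind(F, G)`
as the graph `G` tends to `x` in `Ū`. -/
def tindBar (F : UGraph) (x : Ubar) : ℝ := limUnder (comap toBar (𝓝 x)) (tind F)

/-- The restriction `H|_n` of an infinite graph to its first `n` vertices. -/
def restr (n : ℕ+) (H : SimpleGraph ℕ) : SimpleGraph (Fin n) := H.comap (fun i : Fin n => (i : ℕ))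

/-- The event `H ⊇ F`, where the finite graph `F` is seen as a graph on `ℕ` by adding
isolated vertices. -/
def containsEvent {k : ℕ+} (F : SimpleGraph (Fin k)) : Set (SimpleGraph ℕ) :=
  {H | F.map Fin.valEmbedding ≤ H}

/-- The event `H|_k = F`. -/
def restrEvent {k : ℕ+} (F : SimpleGraph (Fin k)) : Set (SimpleGraph ℕ) := {H | restr k H = F}

/-- The distribution `ν` of a random infinite graph is exchangeable if it is invariant under all
permutations of the vertices. -/
def Exchangeable (ν : ProbabilityMeasure (SimpleGraph ℕ)) : Prop :=
  ∀ p : Equiv.Perm ℕ, (ν : Measure (SimpleGraph ℕ)).map (fun H => H.comap p) = ν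

/-- The set of distributions of exchangeable random infinite graphs. -/
abbrev ExchLaw : Type := {ν : ProbabilityMeasure (SimpleGraph ℕ) // Exchangeable ν}

end GraphLimit

end

open GraphLimit

/-!
The correspondence rests on sampling. For a finite graph `G`, draw an infinite sequence of vertices
with replacement and let `H` be the graph of adjacencies between its terms. Then
`ℙ(H ⊇ F) = t(F, G)` exactly, for every `F` (`arrayLaw_real`, `t_toU`). The space of infinite
arrays of bits is compact, hence so is the space of distributions on it, and the same identity
extends to the closure: every `y` in the closure of `τ(U)` has a law `graphLaw y` with
`ℙ(H ⊇ F) = y(F)` (`exists_law`). The events `H ⊇ F` form a generating π-system, so this law is unique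
and measurable in `y`, and a random limit `Γ` gives the mixture of these laws. The mixture is
exchangeable because `ℙ(H ⊇ F)` depends only on the isomorphism class of `F`
(`exchangeable_of_containsEvent`).

Conversely, if `H` is exchangeable, then `𝔼 t(F, H|_n)` differs from `ℙ(H ⊇ F)` by at most the
probability that a random map `[k] → [n]` is not injective (`Exchangeable.abs_integral_t_sub_le`).
Hence a limit point of the distributions of `H|_n`, which exists by compactness, represents `H`
(`exists_mixture_eq`). Homomorphism densities are multiplicative under disjoint unions, so by the
Stone–Weierstrass theorem their expectations determine a distribution and control weak convergence
(`tendsto_map_limToBar`, `law_ext`). This gives the uniqueness of `Γ` and the convergence of `H|_n`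
to `Γ` in `Ū`.

The set `U_∞` is the product of the closure of `τ(U)` with `{0}`: only finitely many graphs have
`1 / v` bounded below, and blowing up the vertices of a graph keeps its homomorphism densities while
`1 / v` tends to zero (`projHomeo`). For induced densities, sampling with and without replacement
agree asymptotically, so the extension of `t_ind(F, ·)` to `y` is the probability that `graphLaw y`
gives to `H|_k = F` (`tindBar_infToBar`).
-/

noncomputable section

namespace GraphLimit

/-! ### Densities as probabilities over random maps -/

/-- The proportion of all maps `φ : Fin k → Fin n` along which `G` pulls back to a graph
in `Q`; equivalently, the probability that `k` vertices of `G` drawn with replacement span a graph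
in `Q`. -/
def mapDensity {k n : ℕ} (Q : Set (SimpleGraph (Fin k))) (G : SimpleGraph (Fin n)) : ℝ :=
  Nat.card {φ : Fin k → Fin n // G.comap φ ∈ Q} / (n : ℝ) ^ k

lemma t_toU {k n : ℕ+} (F : SimpleGraph (Fin k)) (G : SimpleGraph (Fin n)) :
    t (toU F) (toU G) = mapDensity (Set.Ici F) G := by
  change tL ⟨k, F⟩ ⟨n, G⟩ = _
  unfold tL mapDensity
  congr 1
  · refine congrArg _ (Nat.card_congr ?_)
    exact
      { toFun := fun φ => ⟨φ, fun _ _ h => φ.map_adj h⟩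
        invFun := fun φ => ⟨φ.1, fun h => φ.2 h⟩
        left_inv := fun φ => rfl
        right_inv := fun φ => rfl }
  · simp

/-- The proportion of non-injective maps among all maps `Fin k → Fin n`. -/
def collision (k n : ℕ) : ℝ := 1 - (n.descFactorial k : ℝ) / (n : ℝ) ^ k

lemma tendsto_collision (k : ℕ) : Tendsto (collision k) atTop (𝓝 0) := by
  have h := (Asymptotics.isEquivalent_iff_tendsto_one (u := fun n : ℕ => (n.descFactorial k : ℝ))
    (v := fun n : ℕ => (n : ℝ) ^ k) (l := atTop) ?_).1 (isEquivalent_descFactorial k)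
  · simpa [collision, Function.comp_def] using! h.const_sub 1
  · filter_upwards [eventually_gt_atTop 0] with n hn
    positivity

lemma card_not_injective (k : ℕ) (n : ℕ+) :
    (Nat.card {φ : Fin k → Fin n // ¬ Function.Injective φ} : ℝ)
      = collision k n * ((n : ℕ) : ℝ) ^ k := by
  classical
  have h1 : Nat.card {φ : Fin k → Fin n // Function.Injective φ} = (n : ℕ).descFactorial k := by
    rw [Nat.card_congr (Equiv.subtypeInjectiveEquivEmbedding (Fin k) (Fin n))]
    simp [Fintype.card_embedding_eq]
  have h2 : Nat.card {φ : Fin k → Fin n // Function.Injective φ}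
      + Nat.card {φ : Fin k → Fin n // ¬ Function.Injective φ} = (n : ℕ) ^ k := by
    rw [← Nat.card_sum, Nat.card_congr (Equiv.sumCompl (fun φ : Fin k → Fin n =>
      Function.Injective φ))]
    simp
  have hn : ((n : ℕ) : ℝ) ^ k ≠ 0 := by positivity
  have h3 : ((n : ℕ).descFactorial k : ℝ)
      + Nat.card {φ : Fin k → Fin n // ¬ Function.Injective φ} = ((n : ℕ) : ℝ) ^ k := by
    rw [← h1]; exact_mod_cast h2
  rw [collision, sub_mul, div_mul_cancel₀ _ hn]
  linarith

/-- Sampling vertices with or without replacement makes a difference of at most twice the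
probability of a collision. -/
lemma abs_mapDensity_sub_tind_le {k n : ℕ+} (F : SimpleGraph (Fin k)) (G : SimpleGraph (Fin n)) :
    |mapDensity {F} G - tind (toU F) (toU G)| ≤ 2 * collision k n := by
  classical
  change |_ - tindL ⟨k, F⟩ ⟨n, G⟩| ≤ _
  have hN : Nat.card (F ↪g G)
      = Nat.card {φ : {φ : Fin k → Fin n // G.comap φ ∈ ({F} : Set _)} //
          Function.Injective φ.1} := by
    refine Nat.card_congr
      { toFun := fun φ => ⟨⟨φ, ?_⟩, φ.injective⟩
        invFun := fun φ => ⟨⟨φ.1.1, φ.2⟩, ?_⟩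
        left_inv := fun φ => rfl
        right_inv := fun φ => rfl }
    · ext a b
      exact φ.map_adj_iff
    · intro a b
      have := φ.1.2
      rw [Set.mem_singleton_iff] at this
      exact iff_of_eq (congrFun (congrFun (congrArg SimpleGraph.Adj this) a) b)
  have hA : Nat.card {φ : Fin k → Fin n // G.comap φ ∈ ({F} : Set _)}
      ≤ Nat.card (F ↪g G) + Nat.card {φ : Fin k → Fin n // ¬ Function.Injective φ} := by
    rw [hN, ← Nat.card_congr (Equiv.sumCompl
      (fun φ : {φ : Fin k → Fin n // G.comap φ ∈ ({F} : Set _)} => Function.Injective φ.1)),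
      Nat.card_sum]
    gcongr
    exact Nat.card_le_card_of_injective
      (fun φ => (⟨φ.1.1, φ.2⟩ : {φ : Fin k → Fin n // ¬ Function.Injective φ}))
      (fun φ ψ h => Subtype.ext (Subtype.ext (Subtype.mk.inj h)))
  have hNA : Nat.card (F ↪g G) ≤ Nat.card {φ : Fin k → Fin n // G.comap φ ∈ ({F} : Set _)} := by
    rw [hN]
    exact Nat.card_le_card_of_injective _ Subtype.val_injective
  have hD : Nat.card (Fin k ↪ Fin n) = (n : ℕ).descFactorial k := by
    simp [Fintype.card_embedding_eq]
  have hND : Nat.card (F ↪g G) ≤ (n : ℕ).descFactorial k := by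
    rw [← hD]
    exact Nat.card_le_card_of_injective (fun φ : F ↪g G => φ.toEmbedding)
      (fun φ ψ h => RelEmbedding.ext fun x => DFunLike.congr_fun h x)
  have hc := card_not_injective k n
  unfold tindL mapDensity
  rw [show Nat.card (Fin (⟨k, F⟩ : LGraph).1 ↪ Fin (⟨n, G⟩ : LGraph).1)
    = (n : ℕ).descFactorial k from hD]
  change |_ - (Nat.card (F ↪g G) : ℝ) / _| ≤ _
  have hp : (0 : ℝ) < ((n : ℕ) : ℝ) ^ (k : ℕ) := by positivity
  generalize Nat.card {φ : Fin k → Fin n // G.comap φ ∈ ({F} : Set _)} = A at *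
  generalize Nat.card (F ↪g G) = N at *
  generalize hcol : collision k n = c at *
  unfold collision at hcol
  generalize (n : ℕ).descFactorial k = D at *
  generalize ((n : ℕ) : ℝ) ^ (k : ℕ) = M at *
  have hA' : (A : ℝ) ≤ N + c * M := by rw [← hc]; exact_mod_cast hA
  have hNA' : (N : ℝ) ≤ A := by exact_mod_cast hNA
  have hND' : (N : ℝ) ≤ D := by exact_mod_cast hND
  have hc0 : 0 ≤ c * M := hc ▸ Nat.cast_nonneg _
  have hc1 : 0 ≤ c := nonneg_of_mul_nonneg_left hc0 hp
  have hDM : (D : ℝ) = (1 - c) * M := by rw [← hcol]; field_simp; ring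
  have h1 : (A : ℝ) / M ≤ N / M + c := by
    rw [div_le_iff₀ hp, add_mul, div_mul_cancel₀ _ hp.ne']; exact hA'
  have h2 : (N : ℝ) / M ≤ A / M := by gcongr
  -- for `D = 0` there are no embeddings and both quotients vanish
  have h3 : (N : ℝ) / M ≤ N / D ∧ (N : ℝ) / D ≤ N / M + c := by
    rcases Nat.eq_zero_or_pos D with h0 | h0
    · subst h0
      have : N = 0 := by exact_mod_cast le_antisymm hND' (by simp)
      subst this
      simpa using hc1
    · have hD0 : (0 : ℝ) < D := by exact_mod_cast h0
      constructor
      · gcongr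
        nlinarith
      · have e : (N : ℝ) / D - N / M = N / D * c := by
          have : (N : ℝ) / M = N / D * (D / M) := by field_simp
          rw [this, hDM, mul_div_cancel_right₀ _ hp.ne']; ring
        have : (N : ℝ) / D * c ≤ 1 * c := by
          gcongr
          exact div_le_one_of_le₀ hND' hD0.le
        linarith
  rw [abs_le]
  constructor <;> linarith [h3.1, h3.2]

lemma mapDensity_eq_sum {k n : ℕ} (Q : Set (SimpleGraph (Fin k))) [DecidablePred (· ∈ Q)]
    (G : SimpleGraph (Fin n)) :
    mapDensity Q G = (∑ φ : Fin k → Fin n, if G.comap φ ∈ Q then (1 : ℝ) else 0) / (n : ℝ) ^ k := by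
  rw [mapDensity, Finset.sum_boole, Nat.card_eq_fintype_card, Fintype.card_subtype]

/-! ### Products, the unit, and blow-ups -/

lemma toU_surjective (G : UGraph) : ∃ (n : ℕ+) (F : SimpleGraph (Fin n)), G = toU F := by
  induction G using Quotient.inductionOn with
  | h F => exact ⟨F.1, F.2, rfl⟩

/-- Homomorphism densities are multiplicative: the product of two of them is the homomorphism
density of the disjoint union. -/
lemma exists_t_mul (F₁ F₂ : UGraph) : ∃ F : UGraph, ∀ G, t F G = t F₁ G * t F₂ G := by
  obtain ⟨k, F₁, rfl⟩ := toU_surjective F₁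
  obtain ⟨l, F₂, rfl⟩ := toU_surjective F₂
  let F : SimpleGraph (Fin (k + l : ℕ+)) :=
    (F₁ ⊕g F₂).comap (finSumFinEquiv (m := k) (n := l)).symm
  have hF : ∀ a b : Fin k ⊕ Fin l,
      F.Adj (finSumFinEquiv a) (finSumFinEquiv b) ↔ (F₁ ⊕g F₂).Adj a b := fun a b => by
    change (F₁ ⊕g F₂).Adj (finSumFinEquiv.symm (finSumFinEquiv a))
      (finSumFinEquiv.symm (finSumFinEquiv b)) ↔ _
    rw [Equiv.symm_apply_apply, Equiv.symm_apply_apply]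
  refine ⟨toU F, fun G => ?_⟩
  obtain ⟨n, G, rfl⟩ := toU_surjective G
  rw [t_toU, t_toU, t_toU]
  have hcard : Nat.card {φ : Fin (k + l : ℕ+) → Fin n // G.comap φ ∈ Set.Ici F}
      = Nat.card {φ : Fin k → Fin n // G.comap φ ∈ Set.Ici F₁}
        * Nat.card {φ : Fin l → Fin n // G.comap φ ∈ Set.Ici F₂} := by
    rw [← Nat.card_prod]
    refine Nat.card_congr ?_
    let e : (Fin (k + l : ℕ+) → Fin n) ≃ (Fin k → Fin n) × (Fin l → Fin n) :=
      (Equiv.arrowCongr (finSumFinEquiv (m := k) (n := l)).symm (Equiv.refl (Fin n))).trans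
        (Equiv.sumArrowEquivProdArrow (Fin k) (Fin l) (Fin n))
    refine (e.subtypeEquiv (q := fun p => G.comap p.1 ∈ Set.Ici F₁ ∧ G.comap p.2 ∈ Set.Ici F₂)
      (fun φ => ?_)).trans (Equiv.subtypeProdEquivProd
        (p := fun φ : Fin k → Fin n => G.comap φ ∈ Set.Ici F₁)
        (q := fun φ : Fin l → Fin n => G.comap φ ∈ Set.Ici F₂))
    constructor
    · intro h
      refine ⟨fun a b hab => ?_, fun a b hab => ?_⟩
      · exact h ((hF (.inl a) (.inl b)).2 hab)
      · exact h ((hF (.inr a) (.inr b)).2 hab)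
    · rintro ⟨h1, h2⟩ a b hab
      obtain ⟨a, rfl⟩ := (finSumFinEquiv (m := k) (n := l)).surjective a
      obtain ⟨b, rfl⟩ := (finSumFinEquiv (m := k) (n := l)).surjective b
      have hab : (F₁ ⊕g F₂).Adj a b := (hF a b).1 hab
      rcases a with a | a <;> rcases b with b | b
      · exact h1 (by simpa using hab)
      · simp at hab
      · simp at hab
      · exact h2 (by simpa using hab)
  unfold mapDensity
  rw [hcard, PNat.add_coe, pow_add]
  push_cast
  ring

/-- The one-vertex graph has homomorphism density one in every graph. -/
lemma t_one_vertex (G : UGraph) : t (toU (n := 1) ⊥) G = 1 := by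
  obtain ⟨n, G, rfl⟩ := toU_surjective G
  rw [t_toU, mapDensity, Set.Ici_bot,
    Nat.card_congr (Equiv.subtypeUnivEquiv fun φ => Set.mem_univ _)]
  simp

/-- The blow-up of `G` in which every vertex is replaced by `m` independent copies. -/
def blowUp {n : ℕ+} (G : SimpleGraph (Fin n)) (m : ℕ+) : SimpleGraph (Fin (n * m : ℕ+)) :=
  G.comap (fun x => (finProdFinEquiv (m := n) (n := m)).symm x |>.1)

lemma t_blowUp (F : UGraph) {n : ℕ+} (G : SimpleGraph (Fin n)) (m : ℕ+) :
    t F (toU (blowUp G m)) = t F (toU G) := by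
  obtain ⟨k, F, rfl⟩ := toU_surjective F
  rw [t_toU, t_toU]
  have hcard : Nat.card {φ : Fin k → Fin (n * m : ℕ+) // (blowUp G m).comap φ ∈ Set.Ici F}
      = Nat.card {φ : Fin k → Fin n // G.comap φ ∈ Set.Ici F} * (m : ℕ) ^ (k : ℕ) := by
    have : (m : ℕ) ^ (k : ℕ) = Nat.card {φ : Fin k → Fin m // True} := by
      rw [Nat.card_congr (Equiv.subtypeUnivEquiv fun _ => trivial)]
      simp
    rw [this, ← Nat.card_prod]
    refine Nat.card_congr ?_
    let e : (Fin k → Fin (n * m : ℕ+)) ≃ (Fin k → Fin n) × (Fin k → Fin m) :=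
      (Equiv.arrowCongr (Equiv.refl (Fin k)) (finProdFinEquiv (m := n) (n := m)).symm).trans
        (Equiv.arrowProdEquivProdArrow (Fin k) (fun _ => Fin n) (fun _ => Fin m))
    refine (e.subtypeEquiv (q := fun p => G.comap p.1 ∈ Set.Ici F ∧ True)
      (fun φ => ?_)).trans (Equiv.subtypeProdEquivProd
        (p := fun φ : Fin k → Fin n => G.comap φ ∈ Set.Ici F) (q := fun _ => True))
    rw [and_true]
    rfl
  unfold mapDensity
  have h1 : ((m : ℕ) : ℝ) ^ (k : ℕ) ≠ 0 := by positivity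
  rw [hcard, PNat.mul_coe]
  push_cast
  rw [mul_pow, mul_div_mul_right _ _ h1]

lemma v_toU {n : ℕ+} (G : SimpleGraph (Fin n)) : (toU G).v = n := rfl

/-! ### Proper graph limits as the closure of the homomorphism densities -/

lemma tau_blowUp {n : ℕ+} (G : SimpleGraph (Fin n)) (m : ℕ+) :
    tau (toU (blowUp G m)) = tau (toU G) :=
  funext fun F => Subtype.ext (t_blowUp F G m)

lemma finite_setOf_v_le (N : ℕ+) : {G : UGraph | G.v ≤ N}.Finite := by
  refine ((Set.finite_Iic N).biUnion fun n _ =>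
    Set.finite_range (toU : SimpleGraph (Fin n) → UGraph)).subset ?_
  intro G hG
  obtain ⟨n, G, rfl⟩ := toU_surjective G
  exact Set.mem_biUnion (x := n) hG ⟨G, rfl⟩

/-- Only finitely many graphs have a given lower bound on `1 / v(G)`, so a point of the closure with
positive last coordinate is itself a graph. -/
lemma mem_range_tauPlus_of_pos {x : (UGraph → I) × I} (hx : x ∈ Ubar) (h0 : 0 < (x.2 : ℝ)) :
    x ∈ Set.range tauPlus := by
  obtain ⟨N, hN⟩ := exists_nat_gt ((x.2 : ℝ)⁻¹)
  have hN0 : 0 < N := Nat.cast_pos.1 ((inv_pos.2 h0).trans hN)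
  have hfin : (tauPlus '' {G : UGraph | G.v ≤ ⟨N, hN0⟩}).Finite := (finite_setOf_v_le _).image _
  let O : Set ((UGraph → I) × I) := {z | (N : ℝ)⁻¹ < z.2}
  have hO : IsOpen O := isOpen_lt continuous_const (by fun_prop)
  have hxO : x ∈ O := by
    change (N : ℝ)⁻¹ < x.2
    exact inv_lt_of_inv_lt₀ h0 hN
  have h1 : x ∈ closure (O ∩ Set.range tauPlus) := hO.inter_closure ⟨hxO, hx⟩
  have h2 : O ∩ Set.range tauPlus ⊆ tauPlus '' {G : UGraph | G.v ≤ ⟨N, hN0⟩} := by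
    rintro _ ⟨hz, G, rfl⟩
    refine ⟨G, ?_, rfl⟩
    have hz : (N : ℝ)⁻¹ < ((G.v : ℕ) : ℝ)⁻¹ := hz
    have : ((G.v : ℕ) : ℝ) < N := by
      refine (inv_lt_inv₀ ?_ ?_).1 hz <;> positivity
    have : (G.v : ℕ) < N := by exact_mod_cast this
    exact this.le
  have h3 := closure_minimal h2 hfin.isClosed h1
  exact Set.image_subset_range _ _ h3

lemma fst_mem_UstarBar {x : (UGraph → I) × I} (hx : x ∈ Ubar) : x.1 ∈ UstarBar := by
  have h := image_closure_subset_closure_image (s := Set.range tauPlus)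
    (continuous_fst : Continuous fun x : (UGraph → I) × I => x.1) ⟨x, hx, rfl⟩
  rwa [← Set.range_comp] at h

lemma snd_eq_zero_of_mem_Uinf {x : (UGraph → I) × I} (hx : x ∈ Uinf) : x.2 = 0 := by
  by_contra h
  exact hx.2 (mem_range_tauPlus_of_pos hx.1 (unitInterval.pos_iff_ne_zero.2 h))

/-- Blowing up a graph leaves its homomorphism densities unchanged while `1 / v` tends to zero. -/
lemma mk_zero_mem_Ubar {y : UGraph → I} (hy : y ∈ UstarBar) : (y, (0 : I)) ∈ Ubar := by
  have hc : IsClosed {y : UGraph → I | (y, (0 : I)) ∈ Ubar} :=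
    isClosed_closure.preimage (by fun_prop)
  refine closure_minimal ?_ hc hy
  rintro _ ⟨G, rfl⟩
  obtain ⟨n, G, rfl⟩ := toU_surjective G
  have hlim : Tendsto (fun m : ℕ => tauPlus (toU (blowUp G m.succPNat))) atTop
      (𝓝 (tau (toU G), (0 : I))) := by
    refine Tendsto.prodMk_nhds ?_ ?_
    · simp only [tau_blowUp]
      exact tendsto_const_nhds
    · rw [tendsto_subtype_rng]
      change Tendsto (fun m : ℕ => ((((toU (blowUp G m.succPNat)).v : ℕ+) : ℕ) : ℝ)⁻¹) atTop
        (𝓝 (0 : ℝ))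
      refine tendsto_inv_atTop_zero.comp (tendsto_natCast_atTop_atTop.comp ?_)
      refine tendsto_atTop_mono (fun m => ?_) tendsto_id
      rw [v_toU, PNat.mul_coe, Nat.succPNat_coe]
      exact (Nat.le_succ m).trans (Nat.le_mul_of_pos_left _ n.pos)
  exact mem_closure_of_tendsto hlim (Eventually.of_forall fun m => ⟨_, rfl⟩)

lemma mk_zero_mem_Uinf {y : UGraph → I} (hy : y ∈ UstarBar) : (y, (0 : I)) ∈ Uinf := by
  refine ⟨mk_zero_mem_Ubar hy, ?_⟩
  rintro ⟨G, hG⟩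
  have h := congrArg (fun x : (UGraph → I) × I => (x.2 : ℝ)) hG
  have h' : ((G.v : ℕ) : ℝ)⁻¹ = 0 := h
  have : (0 : ℝ) < ((G.v : ℕ) : ℝ)⁻¹ := by positivity
  exact this.ne' h'

/-- Forgetting the last coordinate, which vanishes on `U_∞`, is a homeomorphism of `U_∞` onto the
closure of `τ(U)`. -/
def projHomeo : Uinf ≃ₜ UstarBar where
  toFun x := ⟨x.1.1, fst_mem_UstarBar x.2.1⟩
  invFun y := ⟨(y.1, 0), mk_zero_mem_Uinf y.2⟩
  left_inv x := Subtype.ext (Prod.ext rfl (snd_eq_zero_of_mem_Uinf x.2).symm)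
  right_inv _ := rfl
  continuous_toFun := by fun_prop
  continuous_invFun := by fun_prop

instance : CompactSpace UstarBar := isCompact_iff_compactSpace.1 isClosed_closure.isCompact

instance : CompactSpace Ubar := isCompact_iff_compactSpace.1 isClosed_closure.isCompact

/-! ### Events of finitely many adjacencies -/

lemma mem_containsEvent_iff {k : ℕ+} {F : SimpleGraph (Fin k)} {H : SimpleGraph ℕ} :
    H ∈ containsEvent F ↔ F ≤ restr k H := by
  change F.map Fin.valEmbedding ≤ H ↔ _
  rw [SimpleGraph.map_le_iff_le_comap]
  rfl

lemma measurable_restr (n : ℕ+) : Measurable (restr n) := by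
  rw [SimpleGraph.measurable_iff_adj]
  intro u v
  change Measurable fun H : SimpleGraph ℕ => H.Adj u v
  fun_prop

/-- On a finite vertex set every set of graphs is measurable. -/
instance (n : ℕ) : DiscreteMeasurableSpace (SimpleGraph (Fin n)) := by
  have : MeasurableSingletonClass (SimpleGraph (Fin n)) := ⟨fun F => by
    have : ({F} : Set (SimpleGraph (Fin n))) = ⋂ u, ⋂ v, {G | G.Adj u v ↔ F.Adj u v} := by
      ext G
      simp only [Set.mem_singleton_iff, Set.mem_iInter, Set.mem_ofPred_eq]
      exact ⟨fun h => by simp [h], fun h => by ext u v; exact h u v⟩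
    rw [this]
    refine MeasurableSet.iInter fun u => MeasurableSet.iInter fun v => ?_
    have h : Measurable fun G : SimpleGraph (Fin n) => (G.Adj u v ↔ F.Adj u v) := by fun_prop
    exact measurableSet_setOfPred.2 h⟩
  infer_instance

lemma measurableSet_restr_preimage {n : ℕ+} (Q : Set (SimpleGraph (Fin n))) :
    MeasurableSet (restr n ⁻¹' Q) := measurable_restr n (Set.to_countable Q).measurableSet

lemma containsEvent_eq_preimage {k : ℕ+} (F : SimpleGraph (Fin k)) :
    containsEvent F = restr k ⁻¹' Set.Ici F := Set.ext fun _ => mem_containsEvent_iff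

lemma restrEvent_eq_preimage {k : ℕ+} (F : SimpleGraph (Fin k)) :
    restrEvent F = restr k ⁻¹' {F} := rfl

lemma measurableSet_containsEvent {k : ℕ+} (F : SimpleGraph (Fin k)) :
    MeasurableSet (containsEvent F) := by
  rw [containsEvent_eq_preimage]
  exact measurableSet_restr_preimage _

/-- The events `H ⊇ F` with `F` a finite graph. -/
def containsEvents : Set (Set (SimpleGraph ℕ)) :=
  {s | ∃ (k : ℕ+) (F : SimpleGraph (Fin k)), s = containsEvent F}

/-- Every graph on `ℕ` with edges among the first `k` vertices gives an event of the above form. -/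
lemma containsEvent_restr {k : ℕ+} {A : SimpleGraph ℕ} (hA : ∀ u v, A.Adj u v → u < k ∧ v < k) :
    containsEvent (restr k A) = {H | A ≤ H} := by
  ext H
  rw [mem_containsEvent_iff]
  refine ⟨fun h u v huv => ?_, fun h u v huv => h huv⟩
  obtain ⟨hu, hv⟩ := hA u v huv
  exact h (show A.Adj (⟨u, hu⟩ : Fin k) (⟨v, hv⟩ : Fin k) from huv)

lemma map_val_adj_lt {k : ℕ} {F : SimpleGraph (Fin k)} {u v : ℕ}
    (h : (F.map Fin.valEmbedding).Adj u v) : u < k ∧ v < k := by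
  rw [SimpleGraph.map_adj] at h
  obtain ⟨a, b, -, rfl, rfl⟩ := h
  exact ⟨a.2, b.2⟩

lemma isPiSystem_containsEvents : IsPiSystem containsEvents := by
  rintro _ ⟨k, F, rfl⟩ _ ⟨l, F', rfl⟩ -
  refine ⟨k + l, restr (k + l) (F.map Fin.valEmbedding ⊔ F'.map Fin.valEmbedding), ?_⟩
  rw [containsEvent_restr]
  · ext H
    exact (sup_le_iff (a := F.map Fin.valEmbedding) (b := F'.map Fin.valEmbedding) (c := H)).symm
  · rintro u v (h | h) <;> have := map_val_adj_lt h <;> rw [PNat.add_coe] <;> omega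

lemma generateFrom_containsEvents :
    (inferInstance : MeasurableSpace (SimpleGraph ℕ))
      = MeasurableSpace.generateFrom containsEvents := by
  apply le_antisymm
  · have h : Measurable[MeasurableSpace.generateFrom containsEvents,
        (inferInstance : MeasurableSpace (SimpleGraph ℕ))] (fun H : SimpleGraph ℕ => H) := by
      refine (@SimpleGraph.measurable_iff_adj _ _
        (MeasurableSpace.generateFrom containsEvents) _).2 fun u v => ?_
      refine @measurable_to_prop _ (MeasurableSpace.generateFrom containsEvents) _ ?_
      have hp : (fun H : SimpleGraph ℕ => H.Adj u v) ⁻¹' {True} = {H | H.Adj u v} := by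
        ext H; simp
      rw [hp]
      rcases eq_or_ne u v with rfl | huv
      · simp
      · refine MeasurableSpace.measurableSet_generateFrom
          ⟨(u + v).succPNat, restr _ (SimpleGraph.edge u v), ?_⟩
        rw [containsEvent_restr]
        · ext H
          change H.Adj u v ↔ SimpleGraph.edge u v ≤ H
          rw [SimpleGraph.edge_le_iff]
          simp [huv]
        · intro a b hab
          rw [SimpleGraph.edge_adj] at hab
          rw [Nat.succPNat_coe]
          omega
    exact fun s hs => h hs
  · refine MeasurableSpace.generateFrom_le ?_
    rintro _ ⟨k, F, rfl⟩
    exact measurableSet_containsEvent F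

/-- The probabilities of the events `H ⊇ F` determine the distribution of `H`. -/
lemma measure_ext_of_containsEvent {ν ν' : Measure (SimpleGraph ℕ)} [IsProbabilityMeasure ν]
    [IsProbabilityMeasure ν']
    (h : ∀ (k : ℕ+) (F : SimpleGraph (Fin k)), ν.real (containsEvent F) = ν'.real (containsEvent F)) :
    ν = ν' := by
  refine ext_of_generate_finite _ generateFrom_containsEvents isPiSystem_containsEvents ?_ (by simp)
  rintro _ ⟨k, F, rfl⟩
  have := h k F
  rwa [measureReal_eq_measureReal_iff] at this

/-- The event `H ⊇ F` splits according to the graph that `H` induces on the first vertices. -/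
lemma measureReal_containsEvent_eq_sum (ν : Measure (SimpleGraph ℕ)) [IsProbabilityMeasure ν]
    {k : ℕ+} (F : SimpleGraph (Fin k)) [DecidablePred (F ≤ ·)] :
    ν.real (containsEvent F) = ∑ F' with F ≤ F', ν.real (restrEvent F') := by
  have h : containsEvent F = ⋃ F' ∈ Finset.univ.filter (F ≤ ·), restrEvent F' := by
    ext H
    simp [mem_containsEvent_iff, restrEvent]
  rw [h, measureReal_biUnion_finset]
  · intro F₁ _ F₂ _ hne
    exact Set.disjoint_left.2 fun H h1 h2 => hne (h1.symm.trans h2)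
  · exact fun F' _ => measurableSet_restr_preimage {F'}

/-- The probabilities of the events `H|_k = F` determine the distribution of `H`. -/
lemma measure_ext_of_restrEvent {ν ν' : Measure (SimpleGraph ℕ)} [IsProbabilityMeasure ν]
    [IsProbabilityMeasure ν']
    (h : ∀ (k : ℕ+) (F : SimpleGraph (Fin k)), ν.real (restrEvent F) = ν'.real (restrEvent F)) :
    ν = ν' := by
  classical
  refine measure_ext_of_containsEvent fun k F => ?_
  simp only [measureReal_containsEvent_eq_sum, h]

/-! ### The random infinite graph of a graph limit -/

/-- The graph on `ℕ` coded by a `0`-`1` array. The space of arrays carries the compact product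
topology. -/
def ofArray (c : ℕ × ℕ → Bool) : SimpleGraph ℕ := SimpleGraph.fromRel fun i j => c (i, j) = true

lemma continuous_ofArray_adj (i j : ℕ) : Continuous fun c : ℕ × ℕ → Bool =>
    decide (i ≠ j) && (c (i, j) || c (j, i)) := by
  have h : Continuous fun p : Bool × Bool => decide (i ≠ j) && (p.1 || p.2) :=
    continuous_of_discreteTopology
  have h' : Continuous fun c : ℕ × ℕ → Bool => (c (i, j), c (j, i)) :=
    (continuous_apply _).prodMk (continuous_apply _)
  exact h.comp h'

lemma isClopen_ofArray_adj (i j : ℕ) : IsClopen {c | (ofArray c).Adj i j} := by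
  have h : {c | (ofArray c).Adj i j}
      = (fun c : ℕ × ℕ → Bool => decide (i ≠ j) && (c (i, j) || c (j, i))) ⁻¹' {true} := by
    ext c
    simp [ofArray]
  rw [h]
  exact (isClopen_discrete _).preimage (continuous_ofArray_adj i j)

lemma measurable_ofArray : Measurable ofArray := by
  rw [SimpleGraph.measurable_iff_adj]
  exact fun i j => measurableSet_setOfPred.1 (isClopen_ofArray_adj i j).isOpen.measurableSet

lemma isClopen_ofArray_containsEvent {k : ℕ+} (F : SimpleGraph (Fin k)) :
    IsClopen (ofArray ⁻¹' containsEvent F) := by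
  have h : ofArray ⁻¹' containsEvent F
      = ⋂ p ∈ {p : Fin k × Fin k | F.Adj p.1 p.2}, {c | (ofArray c).Adj p.1 p.2} := by
    ext c
    simp only [Set.mem_preimage, mem_containsEvent_iff, Set.mem_iInter]
    exact ⟨fun h p hp => h hp, fun h a b hab => h (a, b) hab⟩
  rw [h]
  exact (Set.toFinite _).isClopen_biInter fun p _ => isClopen_ofArray_adj _ _

/-- The uniform distribution on the vertices of a graph. -/
def vertexLaw (n : ℕ+) : Measure (Fin n) := (PMF.uniformOfFintype (Fin n)).toMeasure

instance (n : ℕ+) : IsProbabilityMeasure (vertexLaw n) := by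
  unfold vertexLaw; infer_instance

/-- The distribution of an infinite sequence of vertices drawn with replacement. -/
def sequenceLaw (n : ℕ+) : Measure (ℕ → Fin n) := Measure.infinitePi fun _ => vertexLaw n

instance (n : ℕ+) : IsProbabilityMeasure (sequenceLaw n) := by
  unfold sequenceLaw; infer_instance

lemma sequenceLaw_real_cylinder (n : ℕ+) {k : ℕ} (φ : Fin k → Fin n) :
    (sequenceLaw n).real {X | (fun i : Fin k => X i) = φ} = (((n : ℕ) : ℝ) ^ k)⁻¹ := by
  let s : ℕ → Set (Fin n) := fun i => if h : i < k then {φ ⟨i, h⟩} else Set.univ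
  have h : {X : ℕ → Fin n | (fun i : Fin k => X i) = φ} = Set.pi (Finset.range k) s := by
    ext X
    simp only [Set.mem_ofPred_eq, Set.mem_pi, Finset.coe_range, Set.mem_Iio, funext_iff]
    refine ⟨fun h i hi => ?_, fun h i => ?_⟩
    · simp only [s, hi, dif_pos, Set.mem_singleton_iff]
      exact h ⟨i, hi⟩
    · have := h i i.2
      simpa [s] using this
  rw [h, Measure.real, sequenceLaw, Measure.infinitePi_pi _ fun i _ => (Set.toFinite _).measurableSet]
  have h2 : ∀ i ∈ Finset.range k, vertexLaw n (s i) = ((n : ℕ) : ENNReal)⁻¹ := by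
    intro i hi
    classical
    rw [vertexLaw, PMF.toMeasure_uniformOfFintype_apply _ (Set.toFinite _).measurableSet]
    simp [s, Finset.mem_range.1 hi]
  rw [Finset.prod_congr rfl h2]
  simp

/-- The array of adjacencies between the vertices of a sequence. -/
def adjArray {n : ℕ+} (G : SimpleGraph (Fin n)) (X : ℕ → Fin n) : ℕ × ℕ → Bool := by
  classical exact fun p => decide (G.Adj (X p.1) (X p.2))

lemma measurable_adjArray {n : ℕ+} (G : SimpleGraph (Fin n)) : Measurable (adjArray G) := by
  classical
  refine measurable_pi_lambda _ fun p => ?_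
  exact (measurable_of_finite fun q : Fin n × Fin n => decide (G.Adj q.1 q.2)).comp
    (Measurable.prodMk (f := fun X : ℕ → Fin n => X p.1) (g := fun X => X p.2)
      (measurable_pi_apply _) (measurable_pi_apply _))

lemma restr_ofArray_adjArray {n : ℕ+} (G : SimpleGraph (Fin n)) (X : ℕ → Fin n) (k : ℕ+) :
    restr k (ofArray (adjArray G X)) = G.comap fun i : Fin k => X i := by
  ext a b
  simp only [restr, ofArray, adjArray, SimpleGraph.comap_adj, SimpleGraph.fromRel_adj,
    decide_eq_true_eq]
  refine ⟨?_, fun h => ⟨fun hab => h.ne (congrArg X hab), Or.inl h⟩⟩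
  rintro ⟨-, h | h⟩
  exacts [h, h.symm]

/-- The distribution of the array of adjacencies between vertices of `G` drawn with replacement. -/
def arrayLaw {n : ℕ+} (G : SimpleGraph (Fin n)) : ProbabilityMeasure (ℕ × ℕ → Bool) :=
  ⟨(sequenceLaw n).map (adjArray G),
    Measure.isProbabilityMeasure_map (measurable_adjArray G).aemeasurable⟩

lemma arrayLaw_real {n : ℕ+} (G : SimpleGraph (Fin n)) {k : ℕ+} (Q : Set (SimpleGraph (Fin k))) :
    (arrayLaw G : Measure _).real (ofArray ⁻¹' (restr k ⁻¹' Q)) = mapDensity Q G := by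
  classical
  rw [arrayLaw, ProbabilityMeasure.coe_mk, map_measureReal_apply (measurable_adjArray G)
    (measurable_ofArray (measurableSet_restr_preimage Q))]
  have h : adjArray G ⁻¹' (ofArray ⁻¹' (restr k ⁻¹' Q))
      = ⋃ φ ∈ Finset.univ.filter (fun φ : Fin k → Fin n => G.comap φ ∈ Q),
        {X : ℕ → Fin n | (fun i : Fin k => X i) = φ} := by
    ext X
    simp [restr_ofArray_adjArray]
  rw [h, measureReal_biUnion_finset]
  · simp only [sequenceLaw_real_cylinder]
    rw [Finset.sum_const, nsmul_eq_mul, mapDensity, div_eq_mul_inv, Nat.card_eq_fintype_card,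
      Fintype.card_subtype]
  · intro φ _ ψ _ hne
    exact Set.disjoint_left.2 fun X h1 h2 => hne (h1.symm.trans h2)
  · intro φ _
    have : Measurable fun (X : ℕ → Fin n) (i : Fin k) => X i := by fun_prop
    exact this (measurableSet_singleton φ)

/-- By compactness of the space of distributions of arrays, every point of the closure of `τ(U)`
gives the probabilities of the events `H ⊇ F` for some random infinite graph `H`. -/
lemma exists_law {y : UGraph → I} (hy : y ∈ UstarBar) :
    ∃ P : ProbabilityMeasure (ℕ × ℕ → Bool), ∀ (k : ℕ+) (F : SimpleGraph (Fin k)),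
      (P : Measure (ℕ × ℕ → Bool)).real (ofArray ⁻¹' containsEvent F) = y (toU F) := by
  let S : Set (ProbabilityMeasure (ℕ × ℕ → Bool) × (UGraph → I)) :=
    {z | ∀ (k : ℕ+) (F : SimpleGraph (Fin k)),
      (z.1 : Measure (ℕ × ℕ → Bool)).real (ofArray ⁻¹' containsEvent F) = z.2 (toU F)}
  -- the events `H ⊇ F` are clopen in the space of arrays, so their probabilities are continuous
  have hS : IsClosed S := by
    simp only [S, Set.ofPred_forall]
    refine isClosed_iInter fun k => isClosed_iInter fun F => isClosed_eq ?_ (by fun_prop)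
    have h : Continuous fun P : ProbabilityMeasure (ℕ × ℕ → Bool) =>
        P (ofArray ⁻¹' containsEvent F) := continuous_iff_continuousAt.2 fun P =>
      ProbabilityMeasure.tendsto_measure_of_isClopen_of_tendsto tendsto_id
        (isClopen_ofArray_containsEvent F)
    exact NNReal.continuous_coe.comp (h.comp continuous_fst)
  have hcl : IsClosed (Prod.snd '' S) := isClosedMap_snd_of_compactSpace _ hS
  have hsub : Set.range tau ⊆ Prod.snd '' S := by
    rintro _ ⟨G, rfl⟩
    obtain ⟨n, G, rfl⟩ := toU_surjective G
    refine ⟨(arrayLaw G, tau (toU G)), fun k F => ?_, rfl⟩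
    rw [containsEvent_eq_preimage]
    exact (arrayLaw_real G _).trans (t_toU F G).symm
  obtain ⟨⟨P, y'⟩, hP, rfl⟩ := closure_minimal hsub hcl hy
  exact ⟨P, hP⟩

/-- The distribution of the random infinite graph with `ℙ(H ⊇ F) = y(F)` for all `F`. -/
def graphLaw (y : UstarBar) : Measure (SimpleGraph ℕ) :=
  ((exists_law y.2).choose : Measure (ℕ × ℕ → Bool)).map ofArray

instance (y : UstarBar) : IsProbabilityMeasure (graphLaw y) :=
  Measure.isProbabilityMeasure_map measurable_ofArray.aemeasurable

lemma graphLaw_real_containsEvent (y : UstarBar) {k : ℕ+} (F : SimpleGraph (Fin k)) :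
    (graphLaw y).real (containsEvent F) = y.1 (toU F) := by
  rw [graphLaw, map_measureReal_apply measurable_ofArray (measurableSet_containsEvent F)]
  exact (exists_law y.2).choose_spec k F

lemma continuous_coord (F : UGraph) : Continuous fun y : UstarBar => (y.1 F : ℝ) :=
  continuous_subtype_val.comp ((continuous_apply F).comp continuous_subtype_val)

lemma measurable_graphLaw : Measurable graphLaw := by
  refine .measure_of_isPiSystem_of_isProbabilityMeasure generateFrom_containsEvents
    isPiSystem_containsEvents ?_
  rintro _ ⟨k, F, rfl⟩
  have h : (fun y => graphLaw y (containsEvent F))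
      = fun y : UstarBar => ENNReal.ofReal (y.1 (toU F)) := by
    funext y
    rw [← graphLaw_real_containsEvent, ofReal_measureReal]
  rw [h]
  exact (continuous_coord _).measurable.ennreal_ofReal

/-! ### Induced densities of graph limits -/

/-- The graph law of a finite graph is that of the graph induced by vertices drawn with
replacement. -/
lemma graphLaw_real_restrEvent {n k : ℕ+} (G : SimpleGraph (Fin n))
    (hG : tau (toU G) ∈ UstarBar) (F : SimpleGraph (Fin k)) :
    (graphLaw ⟨tau (toU G), hG⟩).real (restrEvent F) = mapDensity {F} G := by
  have := Measure.isProbabilityMeasure_map (μ := (arrayLaw G : Measure (ℕ × ℕ → Bool)))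
    measurable_ofArray.aemeasurable
  have h : graphLaw ⟨tau (toU G), hG⟩ = (arrayLaw G : Measure (ℕ × ℕ → Bool)).map ofArray := by
    refine measure_ext_of_containsEvent fun l F' => ?_
    rw [graphLaw_real_containsEvent, map_measureReal_apply measurable_ofArray
      (measurableSet_containsEvent F'), containsEvent_eq_preimage, arrayLaw_real]
    exact t_toU F' G
  rw [h, restrEvent_eq_preimage,
    map_measureReal_apply measurable_ofArray (measurableSet_restr_preimage {F})]
  exact arrayLaw_real G {F}

/-- Inclusion-exclusion, as a downward induction on `F`. -/
lemma continuous_graphLaw_restrEvent {k : ℕ+} (F : SimpleGraph (Fin k)) :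
    Continuous fun y : UstarBar => (graphLaw y).real (restrEvent F) := by
  classical
  induction F using WellFoundedGT.induction with
  | ind F ih =>
    have h : (fun y : UstarBar => (graphLaw y).real (restrEvent F))
        = fun y => (y.1 (toU F) : ℝ) - ∑ F' with F < F', (graphLaw y).real (restrEvent F') := by
      funext y
      rw [← graphLaw_real_containsEvent, measureReal_containsEvent_eq_sum, eq_sub_iff_add_eq]
      have hs : Finset.univ.filter (F ≤ ·) = insert F (Finset.univ.filter (F < ·)) := by
        ext F'
        simp [le_iff_eq_or_lt, eq_comm]
      rw [hs, Finset.sum_insert (by simp)]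
    rw [h]
    refine (continuous_coord _).sub (continuous_finsetSum _ fun F' hF' => ?_)
    exact ih F' (Finset.mem_filter.1 hF').2

instance comap_toBar_neBot (x : Ubar) : (comap toBar (𝓝 x)).NeBot := by
  rw [comap_neBot_iff]
  intro s hs
  have hd : Dense (Set.range toBar) := by
    intro z
    rw [closure_subtype, ← Set.range_comp]
    exact z.2
  obtain ⟨z, ⟨G, rfl⟩, hz⟩ := hd.inter_nhds_nonempty hs
  exact ⟨G, hz⟩

/-- The graphs converging to a proper limit have sizes tending to infinity. -/
lemma tendsto_v (x : Uinf) :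
    Tendsto (fun G : UGraph => (G.v : ℕ)) (comap toBar (𝓝 (infToBar x))) atTop := by
  have h1 : Tendsto (fun G : UGraph => (((toBar G).1.2 : I) : ℝ))
      (comap toBar (𝓝 (infToBar x))) (𝓝 0) := by
    have hc : Continuous fun z : Ubar => ((z.1.2 : I) : ℝ) := by fun_prop
    have h0 : (((infToBar x).1.2 : I) : ℝ) = 0 := congrArg Subtype.val (snd_eq_zero_of_mem_Uinf x.2)
    rw [← h0]
    exact (hc.tendsto _).comp tendsto_comap
  have h2 : Tendsto (fun G : UGraph => (((G.v : ℕ) : ℝ)⁻¹)⁻¹)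
      (comap toBar (𝓝 (infToBar x))) atTop := by
    refine Tendsto.comp tendsto_inv_nhdsGT_zero (tendsto_nhdsWithin_iff.2 ⟨h1, ?_⟩)
    refine Eventually.of_forall fun G => ?_
    exact inv_pos.2 (Nat.cast_pos (α := ℝ).2 G.v.pos)
  simp only [inv_inv] at h2
  exact tendsto_natCast_atTop_iff.1 h2

/-- The induced densities of a proper graph limit are the distributions of the finite restrictions
of the associated random infinite graph. -/
lemma tindBar_infToBar {k : ℕ+} (F : SimpleGraph (Fin k)) (x : Uinf) :
    tindBar (toU F) (infToBar x) = (graphLaw (projHomeo x)).real (restrEvent F) := by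
  refine Tendsto.limUnder_eq ?_
  let q : Ubar → UstarBar := fun z => ⟨z.1.1, fst_mem_UstarBar z.2⟩
  have hq : Continuous q := by fun_prop
  have h1 : Tendsto (fun G => (graphLaw (q (toBar G))).real (restrEvent F))
      (comap toBar (𝓝 (infToBar x))) (𝓝 ((graphLaw (projHomeo x)).real (restrEvent F))) :=
    (((continuous_graphLaw_restrEvent F).comp hq).tendsto (infToBar x)).comp tendsto_comap
  have h2 : Tendsto (fun G : UGraph => 2 * collision k G.v)
      (comap toBar (𝓝 (infToBar x))) (𝓝 0) := by
    simpa using ((tendsto_collision k).comp (tendsto_v x)).const_mul 2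
  have h3 : Tendsto (fun G => (graphLaw (q (toBar G))).real (restrEvent F) - tind (toU F) G)
      (comap toBar (𝓝 (infToBar x))) (𝓝 0) := by
    refine squeeze_zero_norm (fun G => ?_) h2
    obtain ⟨n, G, rfl⟩ := toU_surjective G
    rw [Real.norm_eq_abs, v_toU]
    refine le_of_eq_of_le ?_ (abs_mapDensity_sub_tind_le F G)
    rw [← graphLaw_real_restrEvent G (subset_closure ⟨_, rfl⟩)]
    rfl
  simpa using h1.sub h3

/-! ### Weak convergence from moments -/

/-- By the Stone–Weierstrass theorem, on a compact space weak convergence can be tested on a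
multiplicative family of continuous functions that separates points. -/
lemma tendsto_of_tendsto_integral_submonoid {K ι : Type*} [TopologicalSpace K] [CompactSpace K]
    [MeasurableSpace K] [OpensMeasurableSpace K] {l : Filter ι} {P : ι → ProbabilityMeasure K}
    {Q : ProbabilityMeasure K} (M : Submonoid C(K, ℝ))
    (hM : ∀ x y : K, x ≠ y → ∃ f ∈ M, f x ≠ f y)
    (h : ∀ f ∈ M, Tendsto (fun i => ∫ x, f x ∂(P i : Measure K)) l (𝓝 (∫ x, f x ∂(Q : Measure K)))) :
    Tendsto P l (𝓝 Q) := by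
  have hint : ∀ (R : ProbabilityMeasure K) (f : C(K, ℝ)), Integrable f (R : Measure K) :=
    fun R f => (BoundedContinuousFunction.mkOfCompact f).integrable _
  have hspan : ∀ f ∈ Algebra.adjoin ℝ (M : Set C(K, ℝ)),
      Tendsto (fun i => ∫ x, f x ∂(P i : Measure K)) l (𝓝 (∫ x, f x ∂(Q : Measure K))) := by
    intro f hf
    rw [← Subalgebra.mem_toSubmodule, Algebra.adjoin_eq_span, Submonoid.closure_eq] at hf
    induction hf using Submodule.span_induction with
    | mem f hf => exact h f hf
    | zero => simpa using tendsto_const_nhds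
    | add f g _ _ hf hg =>
      simp only [ContinuousMap.add_apply]
      rw [integral_add (hint Q f) (hint Q g)]
      simp_rw [fun i => integral_add (hint (P i) f) (hint (P i) g)]
      exact hf.add hg
    | smul c f _ hf =>
      simp only [ContinuousMap.smul_apply, smul_eq_mul, integral_const_mul]
      exact hf.const_mul c
  have hsep : (Algebra.adjoin ℝ (M : Set C(K, ℝ))).SeparatesPoints := by
    intro x y hxy
    obtain ⟨f, hf, hne⟩ := hM x y hxy
    exact ⟨f, ⟨f, Algebra.subset_adjoin hf, rfl⟩, hne⟩
  rw [ProbabilityMeasure.tendsto_iff_forall_integral_tendsto]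
  intro f
  rw [Metric.tendsto_nhds]
  intro ε hε
  obtain ⟨g, hg⟩ := ContinuousMap.exists_mem_subalgebra_near_continuousMap_of_separatesPoints
    _ hsep f.toContinuousMap (ε / 3) (by positivity)
  have hclose : ∀ R : ProbabilityMeasure K,
      |∫ x, f x ∂(R : Measure K) - ∫ x, (g : C(K, ℝ)) x ∂(R : Measure K)| ≤ ε / 3 := by
    intro R
    rw [← integral_sub (f.integrable _) (hint R _)]
    have := norm_integral_le_of_norm_le_const (μ := (R : Measure K)) (C := ε / 3)
      (f := fun x => f x - (g : C(K, ℝ)) x) (Eventually.of_forall fun x => ?_)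
    · simpa using this
    · rw [norm_sub_rev]
      exact (ContinuousMap.norm_coe_le_norm ((g : C(K, ℝ)) - f.toContinuousMap) x).trans hg.le
  filter_upwards [Metric.tendsto_nhds.1 (hspan g g.2) (ε / 3) (by positivity)] with i hi
  rw [Real.dist_eq] at hi ⊢
  have h1 := abs_le.1 (hclose (P i))
  have h2 := abs_le.1 (hclose Q)
  have h3 := abs_lt.1 hi
  rw [abs_lt]
  constructor <;> linarith [h1.1, h1.2, h2.1, h2.2, h3.1, h3.2]

lemma exists_coord_mul (F₁ F₂ : UGraph) :
    ∃ F : UGraph, ∀ x : Ubar, (x.1.1 F : ℝ) = x.1.1 F₁ * x.1.1 F₂ := by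
  obtain ⟨F, hF⟩ := exists_t_mul F₁ F₂
  refine ⟨F, fun x => ?_⟩
  have hc : IsClosed {z : (UGraph → I) × I | (z.1 F : ℝ) = z.1 F₁ * z.1 F₂} :=
    isClosed_eq (by fun_prop) (by fun_prop)
  refine closure_minimal ?_ hc x.2
  rintro _ ⟨G, rfl⟩
  exact hF G

lemma coord_one_vertex (x : Ubar) : (x.1.1 (toU (n := 1) ⊥) : ℝ) = 1 := by
  have hc : IsClosed {z : (UGraph → I) × I | (z.1 (toU (n := 1) ⊥) : ℝ) = 1} :=
    isClosed_eq (by fun_prop) (by fun_prop)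
  refine closure_minimal ?_ hc x.2
  rintro _ ⟨G, rfl⟩
  exact t_one_vertex G

/-- The functions `t(F, ·) v(·)⁻ʲ` on `Ū`. -/
def monomials : Submonoid C(Ubar, ℝ) where
  carrier := {f | ∃ (F : UGraph) (j : ℕ), ∀ x : Ubar, f x = x.1.1 F * (x.1.2 : ℝ) ^ j}
  one_mem' := ⟨toU (n := 1) ⊥, 0, fun x => by rw [coord_one_vertex]; simp⟩
  mul_mem' := by
    rintro f g ⟨F₁, i, hf⟩ ⟨F₂, j, hg⟩
    obtain ⟨F, hF⟩ := exists_coord_mul F₁ F₂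
    refine ⟨F, i + j, fun x => ?_⟩
    rw [ContinuousMap.mul_apply, hf, hg, hF, pow_add]
    ring

lemma monomials_separate (x y : Ubar) (hxy : x ≠ y) : ∃ f ∈ monomials, f x ≠ f y := by
  by_contra! h
  refine hxy (Subtype.ext (Prod.ext (funext fun F => Subtype.ext ?_) (Subtype.ext ?_)))
  · exact h ⟨fun x => x.1.1 F, by fun_prop⟩ ⟨F, 0, fun x => by simp⟩
  · exact h ⟨fun x => x.1.2, by fun_prop⟩
      ⟨toU (n := 1) ⊥, 1, fun x => by rw [coord_one_vertex]; simp⟩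

/-- The inclusion of the closure of `τ(U)`, identified with `U_∞`, into `Ū`. -/
def limToBar (y : UstarBar) : Ubar := infToBar (projHomeo.symm y)

lemma continuous_limToBar : Continuous limToBar :=
  (continuous_inclusion Set.sdiff_subset).comp projHomeo.symm.continuous

/-- The projection of `Ū` to the closure of `τ(U)`. -/
def barToStar (x : Ubar) : UstarBar := ⟨x.1.1, fst_mem_UstarBar x.2⟩

lemma continuous_barToStar : Continuous barToStar := by
  unfold barToStar
  fun_prop

/-- Weak convergence in `Ū` to a distribution on proper graph limits follows from convergence of
moments. -/
lemma tendsto_map_limToBar {ι : Type*} {l : Filter ι} {P : ι → ProbabilityMeasure Ubar}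
    {ρ : ProbabilityMeasure UstarBar}
    (h : ∀ (F : UGraph) (j : ℕ),
      Tendsto (fun i => ∫ x, (x.1.1 F : ℝ) * (x.1.2 : ℝ) ^ j ∂(P i : Measure Ubar)) l
        (𝓝 ((∫ y, (y.1 F : ℝ) ∂(ρ : Measure UstarBar)) * 0 ^ j))) :
    Tendsto P l (𝓝 (ρ.map continuous_limToBar.measurable.aemeasurable)) := by
  refine tendsto_of_tendsto_integral_submonoid monomials monomials_separate ?_
  rintro f ⟨F, j, hf⟩
  have h2 : ∫ x, f x ∂(ρ.map continuous_limToBar.measurable.aemeasurable : Measure Ubar)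
      = (∫ y, (y.1 F : ℝ) ∂(ρ : Measure UstarBar)) * 0 ^ j := by
    rw [ProbabilityMeasure.toMeasure_map, integral_map continuous_limToBar.measurable.aemeasurable
      f.continuous.aestronglyMeasurable, ← integral_mul_const]
    refine integral_congr_ae (Eventually.of_forall fun y => ?_)
    exact hf (limToBar y)
  rw [h2]
  simpa only [hf] using h F j

/-- A distribution on the closure of `τ(U)` is determined by its expected densities. -/
lemma law_ext {ρ ρ' : ProbabilityMeasure UstarBar}
    (h : ∀ F : UGraph, ∫ y, (y.1 F : ℝ) ∂(ρ : Measure UstarBar)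
      = ∫ y, (y.1 F : ℝ) ∂(ρ' : Measure UstarBar)) : ρ = ρ' := by
  have h1 : ρ.map continuous_limToBar.measurable.aemeasurable
      = ρ'.map continuous_limToBar.measurable.aemeasurable := by
    refine tendsto_nhds_unique (tendsto_const_nhds (f := (⊤ : Filter Unit))) ?_
    refine tendsto_map_limToBar fun F j => ?_
    rw [← h, ProbabilityMeasure.toMeasure_map, integral_map
      continuous_limToBar.measurable.aemeasurable (by fun_prop), ← integral_mul_const]
    exact tendsto_const_nhds
  have h2 : ∀ ρ : ProbabilityMeasure UstarBar,
      ((ρ.map continuous_limToBar.measurable.aemeasurable : ProbabilityMeasure Ubar) :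
        Measure Ubar).map barToStar = (ρ : Measure UstarBar) := by
    intro ρ
    rw [ProbabilityMeasure.toMeasure_map, Measure.map_map continuous_barToStar.measurable
      continuous_limToBar.measurable]
    exact Measure.map_id
  refine Subtype.ext ?_
  change (ρ : Measure UstarBar) = ρ'
  rw [← h2 ρ, h1, h2]

/-! ### Exchangeability -/

lemma exists_perm_extending {α : Type*} {k : ℕ} (x y : Fin k ↪ α) :
    ∃ p : Equiv.Perm α, ∀ i, p (x i) = y i := by
  have := Equiv.Perm.isMultiplyPretransitive α k
  obtain ⟨p, hp⟩ := MulAction.exists_smul_eq (Equiv.Perm α) x y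
  exact ⟨p, fun i => DFunLike.congr_fun hp i⟩

lemma measurable_comap_perm (p : ℕ → ℕ) :
    Measurable fun H : SimpleGraph ℕ => H.comap p := by
  rw [SimpleGraph.measurable_iff_adj]
  intro u v
  change Measurable fun H : SimpleGraph ℕ => H.Adj (p u) (p v)
  fun_prop

lemma containsEvent_map {k n : ℕ+} (F : SimpleGraph (Fin k)) (x : Fin k ↪ Fin n) :
    containsEvent (F.map x) = {H | F ≤ (restr n H).comap x} := by
  ext H
  rw [mem_containsEvent_iff, SimpleGraph.map_le_iff_le_comap]
  rfl

lemma toU_map_eq {k n : ℕ+} (F : SimpleGraph (Fin k)) (x y : Fin k ↪ Fin n) :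
    toU (F.map x) = toU (F.map y) := by
  obtain ⟨q, hq⟩ := exists_perm_extending x y
  refine Quotient.sound ?_
  have h : (F.map x).map q.toEmbedding = F.map y := by
    rw [SimpleGraph.map_map]
    congr 1
    ext i
    exact congrArg Fin.val (hq i)
  refine ⟨?_⟩
  change F.map x ≃g F.map y
  rw [← h]
  exact SimpleGraph.Iso.map q _

/-- A random graph is exchangeable if the probability of containing `F` depends only on the
isomorphism class of `F`. -/
lemma exchangeable_of_containsEvent {ν : ProbabilityMeasure (SimpleGraph ℕ)} (a : UGraph → ℝ)
    (h : ∀ (k : ℕ+) (F : SimpleGraph (Fin k)),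
      (ν : Measure (SimpleGraph ℕ)).real (containsEvent F) = a (toU F)) : Exchangeable ν := by
  intro p
  have hm := measurable_comap_perm p
  have := Measure.isProbabilityMeasure_map (μ := (ν : Measure (SimpleGraph ℕ))) hm.aemeasurable
  refine measure_ext_of_containsEvent fun k F => ?_
  rw [map_measureReal_apply hm (measurableSet_containsEvent F)]
  -- all vertices `i < k` and their images lie below `n`
  obtain ⟨n, hkn, hpn⟩ : ∃ n : ℕ+, k ≤ n ∧ ∀ i : Fin k, p i < n := by
    refine ⟨k + (∑ i : Fin k, p i).succPNat, (PNat.lt_add_right _ _).le, fun i => ?_⟩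
    have : p i ≤ ∑ i : Fin k, p i := Finset.single_le_sum (f := fun i : Fin k => p i)
      (fun _ _ => Nat.zero_le _) (Finset.mem_univ i)
    rw [PNat.add_coe, Nat.succPNat_coe]
    omega
  let x : Fin k ↪ Fin n := Fin.castLEEmb hkn
  let y : Fin k ↪ Fin n := ⟨fun i => ⟨p i, hpn i⟩, fun i j hij =>
    Fin.ext (p.injective (congrArg Fin.val hij))⟩
  have hx : containsEvent F = containsEvent (F.map x) := by
    rw [containsEvent_map]
    ext H
    exact mem_containsEvent_iff
  have hy : (fun H : SimpleGraph ℕ => H.comap p) ⁻¹' containsEvent F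
      = containsEvent (F.map y) := by
    rw [containsEvent_map]
    ext H
    exact mem_containsEvent_iff
  rw [hy, hx, h, h, toU_map_eq F x y]

lemma Exchangeable.real_comap {ν : ProbabilityMeasure (SimpleGraph ℕ)} (hν : Exchangeable ν)
    {k n : ℕ+} (F : SimpleGraph (Fin k)) {φ : Fin k → Fin n} (hφ : Function.Injective φ) :
    (ν : Measure (SimpleGraph ℕ)).real {H | F ≤ (restr n H).comap φ}
      = (ν : Measure (SimpleGraph ℕ)).real (containsEvent F) := by
  obtain ⟨p, hp⟩ := exists_perm_extending (Fin.valEmbedding : Fin k ↪ ℕ)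
    (⟨fun i => φ i, fun i j hij => hφ (Fin.ext hij)⟩ : Fin k ↪ ℕ)
  have hm := measurable_comap_perm p
  conv_rhs => rw [← hν p, map_measureReal_apply hm (measurableSet_containsEvent F)]
  congr 1
  ext H
  rw [Set.mem_preimage, mem_containsEvent_iff]
  have : restr k (H.comap p) = (restr n H).comap φ := by
    ext a b
    change H.Adj (p a) (p b) ↔ H.Adj (φ a) (φ b)
    rw [show p a = φ a from hp a, show p b = φ b from hp b]
  rw [this]
  rfl

/-- In an exchangeable random graph, every injective map of the vertices of `F` to the first `n`
vertices is a homomorphism with probability `ℙ(H ⊇ F)`. -/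
lemma Exchangeable.abs_integral_t_sub_le {ν : ProbabilityMeasure (SimpleGraph ℕ)}
    (hν : Exchangeable ν) {k : ℕ+} (F : SimpleGraph (Fin k)) (n : ℕ+) :
    |∫ H, t (toU F) (toU (restr n H)) ∂(ν : Measure (SimpleGraph ℕ))
      - (ν : Measure (SimpleGraph ℕ)).real (containsEvent F)| ≤ collision k n := by
  classical
  have hms : ∀ φ : Fin k → Fin n, MeasurableSet {H | F ≤ (restr n H).comap φ} := fun φ =>
    measurableSet_restr_preimage {G | F ≤ G.comap φ}
  have h1 : ∫ H, t (toU F) (toU (restr n H)) ∂(ν : Measure (SimpleGraph ℕ))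
      = (∑ φ : Fin k → Fin n, (ν : Measure (SimpleGraph ℕ)).real {H | F ≤ (restr n H).comap φ})
        / ((n : ℕ) : ℝ) ^ (k : ℕ) := by
    simp_rw [t_toU, mapDensity_eq_sum]
    rw [integral_div, integral_finsetSum]
    · congr 1
      refine Finset.sum_congr rfl fun φ _ => ?_
      rw [← integral_indicator_one (hms φ)]
      refine integral_congr_ae (Eventually.of_forall fun H => ?_)
      simp [Set.indicator_apply]
    · intro φ _
      refine ((integrable_const (1 : ℝ)).indicator (hms φ)).congr
        (Eventually.of_forall fun H => ?_)
      simp [Set.indicator_apply]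
  have hp : (0 : ℝ) < ((n : ℕ) : ℝ) ^ (k : ℕ) := by positivity
  set c := (ν : Measure (SimpleGraph ℕ)).real (containsEvent F)
  have h2 : c = (∑ _φ : Fin k → Fin n, c) / ((n : ℕ) : ℝ) ^ (k : ℕ) := by
    rw [Finset.sum_const, Finset.card_univ, Fintype.card_fun, Fintype.card_fin, Fintype.card_fin,
      nsmul_eq_mul]
    push_cast
    rw [mul_div_cancel_left₀ _ hp.ne']
  rw [h1, h2, ← sub_div, ← Finset.sum_sub_distrib, abs_div, abs_of_pos hp, div_le_iff₀ hp,
    ← card_not_injective, Nat.card_eq_fintype_card, Fintype.card_subtype, ← Finset.sum_boole]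
  refine (Finset.abs_sum_le_sum_abs _ _).trans (Finset.sum_le_sum fun φ _ => ?_)
  split_ifs with hφ
  · rw [hν.real_comap F hφ, sub_self, abs_zero]
  · exact abs_sub_le_of_nonneg_of_le measureReal_nonneg measureReal_le_one measureReal_nonneg
      measureReal_le_one

lemma measurable_toBar_restr (n : ℕ+) :
    Measurable fun H : SimpleGraph ℕ => toBar (toU (restr n H)) :=
  (Measurable.of_discrete (f := fun F : SimpleGraph (Fin n) => toBar (toU F))).comp
    (measurable_restr n)

/-- The distribution of `H|_n` as a random element of `Ū`. -/
def restrLaw (ν : ProbabilityMeasure (SimpleGraph ℕ)) (n : ℕ+) : ProbabilityMeasure Ubar :=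
  ν.map (measurable_toBar_restr n).aemeasurable

lemma Exchangeable.tendsto_integral_restrLaw {ν : ProbabilityMeasure (SimpleGraph ℕ)}
    (hν : Exchangeable ν) {k : ℕ+} (F : SimpleGraph (Fin k)) (j : ℕ) :
    Tendsto (fun n => ∫ x, (x.1.1 (toU F) : ℝ) * (x.1.2 : ℝ) ^ j ∂(restrLaw ν n : Measure Ubar))
      atTop (𝓝 ((ν : Measure (SimpleGraph ℕ)).real (containsEvent F) * 0 ^ j)) := by
  have h : ∀ n, ∫ x, (x.1.1 (toU F) : ℝ) * (x.1.2 : ℝ) ^ j ∂(restrLaw ν n : Measure Ubar)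
      = (∫ H, t (toU F) (toU (restr n H)) ∂(ν : Measure (SimpleGraph ℕ)))
        * (((n : ℕ) : ℝ)⁻¹) ^ j := by
    intro n
    rw [restrLaw, ProbabilityMeasure.toMeasure_map, integral_map
      (measurable_toBar_restr n).aemeasurable (by fun_prop), ← integral_mul_const]
    rfl
  simp_rw [h]
  have hv : Tendsto (fun n : ℕ+ => (n : ℕ)) atTop atTop := tendsto_PNat_val_atTop_atTop
  refine Tendsto.mul ?_ ((tendsto_inv_atTop_zero.comp
    (tendsto_natCast_atTop_atTop.comp hv)).pow j)
  rw [tendsto_iff_norm_sub_tendsto_zero]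
  exact squeeze_zero (fun _ => norm_nonneg _) (fun n => hν.abs_integral_t_sub_le F n)
    ((tendsto_collision k).comp hv)

/-! ### The correspondence of distributions -/

/-- The distribution of the random infinite graph associated to a random graph limit. -/
def mixture (ρ : ProbabilityMeasure UstarBar) : ProbabilityMeasure (SimpleGraph ℕ) :=
  ⟨(ρ : Measure UstarBar).bind graphLaw, isProbabilityMeasure_bind
    measurable_graphLaw.aemeasurable (Eventually.of_forall fun _ => inferInstance)⟩

lemma mixture_real (ρ : ProbabilityMeasure UstarBar) {s : Set (SimpleGraph ℕ)}
    (hs : MeasurableSet s) :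
    (mixture ρ : Measure (SimpleGraph ℕ)).real s
      = ∫ y, (graphLaw y).real s ∂(ρ : Measure UstarBar) := by
  rw [mixture, ProbabilityMeasure.coe_mk, Measure.real,
    Measure.bind_apply hs measurable_graphLaw.aemeasurable]
  refine (integral_toReal ?_ ?_).symm
  · exact (Measure.measurable_measure.1 measurable_graphLaw s hs).aemeasurable
  · exact Eventually.of_forall fun y => measure_lt_top _ _

lemma mixture_real_containsEvent (ρ : ProbabilityMeasure UstarBar) {k : ℕ+}
    (F : SimpleGraph (Fin k)) :
    (mixture ρ : Measure (SimpleGraph ℕ)).real (containsEvent F)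
      = ∫ y, (y.1 (toU F) : ℝ) ∂(ρ : Measure UstarBar) := by
  rw [mixture_real ρ (measurableSet_containsEvent F)]
  simp_rw [graphLaw_real_containsEvent]

lemma exchangeable_mixture (ρ : ProbabilityMeasure UstarBar) : Exchangeable (mixture ρ) :=
  exchangeable_of_containsEvent (fun F => ∫ y, (y.1 F : ℝ) ∂(ρ : Measure UstarBar))
    fun _ F => mixture_real_containsEvent ρ F

lemma exchLaw_ext {ν ν' : ExchLaw} (h : (ν.1 : Measure (SimpleGraph ℕ)) = ν'.1) : ν = ν' :=
  Subtype.ext (Subtype.ext h)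

/-- Any limit point of the distributions of `H|_n` represents the distribution of `H`. -/
lemma exists_mixture_eq {ν : ProbabilityMeasure (SimpleGraph ℕ)} (hν : Exchangeable ν) :
    ∃ ρ : ProbabilityMeasure UstarBar,
      (mixture ρ : Measure (SimpleGraph ℕ)) = (ν : Measure (SimpleGraph ℕ)) := by
  let U : Ultrafilter ℕ+ := Ultrafilter.of atTop
  have hU : (U : Filter ℕ+) ≤ atTop := Ultrafilter.of_le _
  let Q : ProbabilityMeasure Ubar := (U.map (restrLaw ν)).lim
  have hQ : Tendsto (restrLaw ν) U (𝓝 Q) := (U.map (restrLaw ν)).le_nhds_lim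
  refine ⟨Q.map continuous_barToStar.measurable.aemeasurable, ?_⟩
  refine measure_ext_of_containsEvent fun k F => ?_
  rw [mixture_real_containsEvent, ProbabilityMeasure.toMeasure_map,
    integral_map continuous_barToStar.measurable.aemeasurable
      (continuous_coord _).aestronglyMeasurable]
  have h1 := (hν.tendsto_integral_restrLaw F 0).mono_left hU
  simp only [pow_zero, mul_one] at h1
  refine tendsto_nhds_unique ?_ h1
  exact (ProbabilityMeasure.tendsto_iff_forall_integral_tendsto.1 hQ)
    (BoundedContinuousFunction.mkOfCompact ⟨fun x : Ubar => (x.1.1 (toU F) : ℝ), by fun_prop⟩)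

/-- The bijection between distributions of random graph limits and of exchangeable random graphs. -/
def exchEquiv : ProbabilityMeasure UstarBar ≃ ExchLaw :=
  Equiv.ofBijective (fun ρ => ⟨mixture ρ, exchangeable_mixture ρ⟩) <| by
    constructor
    · intro ρ ρ' h
      have h : mixture ρ = mixture ρ' := congrArg Subtype.val h
      refine law_ext fun F => ?_
      obtain ⟨k, F, rfl⟩ := toU_surjective F
      rw [← mixture_real_containsEvent, ← mixture_real_containsEvent, h]
    · intro ν
      obtain ⟨ρ, hρ⟩ := exists_mixture_eq ν.2
      exact ⟨ρ, exchLaw_ext hρ⟩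

lemma exchEquiv_eq_iff_restrEvent (ρ : ProbabilityMeasure UstarBar) (ν : ExchLaw) :
    exchEquiv ρ = ν ↔ ∀ (k : ℕ+) (F : SimpleGraph (Fin k)),
      ∫ y, tindBar (toU F) (infToBar (projHomeo.symm y)) ∂(ρ : Measure UstarBar)
        = (ν.1 : Measure (SimpleGraph ℕ)).real (restrEvent F) := by
  have h : ∀ (k : ℕ+) (F : SimpleGraph (Fin k)),
      ∫ y, tindBar (toU F) (infToBar (projHomeo.symm y)) ∂(ρ : Measure UstarBar)
        = (mixture ρ : Measure (SimpleGraph ℕ)).real (restrEvent F) := by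
    intro k F
    simp_rw [tindBar_infToBar, Homeomorph.apply_symm_apply]
    exact (mixture_real ρ (measurableSet_restr_preimage {F})).symm
  simp_rw [h]
  refine ⟨?_, fun H => exchLaw_ext (measure_ext_of_restrEvent H)⟩
  rintro rfl k F
  rfl

lemma exchEquiv_eq_iff_containsEvent (ρ : ProbabilityMeasure UstarBar) (ν : ExchLaw) :
    exchEquiv ρ = ν ↔ ∀ (k : ℕ+) (F : SimpleGraph (Fin k)),
      ∫ y, (y.1 (toU F) : ℝ) ∂(ρ : Measure UstarBar)
        = (ν.1 : Measure (SimpleGraph ℕ)).real (containsEvent F) := by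
  simp_rw [← mixture_real_containsEvent]
  refine ⟨?_, fun H => exchLaw_ext (measure_ext_of_containsEvent H)⟩
  rintro rfl k F
  rfl

lemma tendstoInDistribution_restr (ρ : ProbabilityMeasure UstarBar) :
    TendstoInDistribution (fun (n : ℕ+) (H : SimpleGraph ℕ) => toBar (toU (restr n H))) atTop
      limToBar (fun _ => ((exchEquiv ρ).1 : Measure (SimpleGraph ℕ))) (ρ : Measure UstarBar) where
  forall_aemeasurable n := (measurable_toBar_restr n).aemeasurable
  aemeasurable_limit := continuous_limToBar.measurable.aemeasurable
  tendsto := by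
    refine tendsto_map_limToBar (P := restrLaw (mixture ρ)) (ρ := ρ) fun F j => ?_
    obtain ⟨k, F, rfl⟩ := toU_surjective F
    rw [← mixture_real_containsEvent]
    exact (exchangeable_mixture ρ).tendsto_integral_restrLaw F j

/-- The transport of distributions along a homeomorphism. -/
def lawEquiv {X Y : Type*} [TopologicalSpace X] [MeasurableSpace X] [BorelSpace X]
    [TopologicalSpace Y] [MeasurableSpace Y] [BorelSpace Y] (h : X ≃ₜ Y) :
    ProbabilityMeasure X ≃ ProbabilityMeasure Y where
  toFun μ := μ.map h.continuous.measurable.aemeasurable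
  invFun ρ := ρ.map h.symm.continuous.measurable.aemeasurable
  left_inv μ := by
    refine Subtype.ext ?_
    change ((μ : Measure X).map h).map h.symm = μ
    rw [Measure.map_map h.symm.continuous.measurable h.continuous.measurable]
    simp
  right_inv ρ := by
    refine Subtype.ext ?_
    change ((ρ : Measure Y).map h.symm).map h = ρ
    rw [Measure.map_map h.continuous.measurable h.symm.continuous.measurable]
    simp

lemma integral_lawEquiv {X Y : Type*} [TopologicalSpace X] [MeasurableSpace X] [BorelSpace X]
    [TopologicalSpace Y] [MeasurableSpace Y] [BorelSpace Y] (h : X ≃ₜ Y)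
    (μ : ProbabilityMeasure X) (f : Y → ℝ) :
    ∫ y, f y ∂(lawEquiv h μ : Measure Y) = ∫ x, f (h x) ∂(μ : Measure X) :=
  integral_map_equiv h.toMeasurableEquiv f

end GraphLimit

end

open GraphLimit
theorem theorem5p3 :
    -- the projection identifies the proper graph limits with the closure of `τ(U)`
    ∃ h : Uinf ≃ₜ UstarBar, (∀ x : Uinf, (h x : UGraph → I) = x.1.1) ∧
    -- distributions on the set of proper graph limits
    (∃ e : ProbabilityMeasure Uinf ≃ ExchLaw,
      (∀ (μ : ProbabilityMeasure Uinf) (ν : ExchLaw), e μ = ν ↔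
        ∀ (k : ℕ+) (F : SimpleGraph (Fin k)),
          ∫ x, tindBar (toU F) (infToBar x) ∂(μ : Measure Uinf)
            = (ν.1 : Measure (SimpleGraph ℕ)).real (restrEvent F)) ∧
      (∀ (μ : ProbabilityMeasure Uinf) (ν : ExchLaw), e μ = ν ↔
        ∀ (k : ℕ+) (F : SimpleGraph (Fin k)),
          ∫ x, tBar (toU F) (infToBar x) ∂(μ : Measure Uinf)
            = (ν.1 : Measure (SimpleGraph ℕ)).real (containsEvent F)) ∧
      ∀ μ : ProbabilityMeasure Uinf,
        TendstoInDistribution (fun (n : ℕ+) (H : SimpleGraph ℕ) => toBar (toU (restr n H))) atTop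
          infToBar (fun _ => ((e μ).1 : Measure (SimpleGraph ℕ))) (μ : Measure Uinf)) ∧
    -- distributions on the closure of `τ(U)`
    (∃ e : ProbabilityMeasure UstarBar ≃ ExchLaw,
      (∀ (ρ : ProbabilityMeasure UstarBar) (ν : ExchLaw), e ρ = ν ↔
        ∀ (k : ℕ+) (F : SimpleGraph (Fin k)),
          ∫ y, tindBar (toU F) (infToBar (h.symm y)) ∂(ρ : Measure UstarBar)
            = (ν.1 : Measure (SimpleGraph ℕ)).real (restrEvent F)) ∧
      (∀ (ρ : ProbabilityMeasure UstarBar) (ν : ExchLaw), e ρ = ν ↔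
        ∀ (k : ℕ+) (F : SimpleGraph (Fin k)),
          ∫ y, (y.1 (toU F) : ℝ) ∂(ρ : Measure UstarBar)
            = (ν.1 : Measure (SimpleGraph ℕ)).real (containsEvent F)) ∧
      ∀ ρ : ProbabilityMeasure UstarBar,
        TendstoInDistribution (fun (n : ℕ+) (H : SimpleGraph ℕ) => toBar (toU (restr n H))) atTop
          (fun y => infToBar (h.symm y)) (fun _ => ((e ρ).1 : Measure (SimpleGraph ℕ)))
          (ρ : Measure UstarBar)) := by
  refine ⟨projHomeo, fun _ => rfl, ⟨(lawEquiv projHomeo).trans exchEquiv, ?_, ?_, ?_⟩,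
    exchEquiv, exchEquiv_eq_iff_restrEvent, exchEquiv_eq_iff_containsEvent,
    tendstoInDistribution_restr⟩
  · intro μ ν
    rw [Equiv.trans_apply, exchEquiv_eq_iff_restrEvent]
    simp_rw [integral_lawEquiv, Homeomorph.symm_apply_apply]
  · intro μ ν
    rw [Equiv.trans_apply, exchEquiv_eq_iff_containsEvent]
    simp_rw [integral_lawEquiv]
    rfl
  · intro μ
    have h := tendstoInDistribution_restr (lawEquiv projHomeo μ)
    have hc : Continuous infToBar := continuous_inclusion Set.sdiff_subset
    refine ⟨h.forall_aemeasurable, hc.measurable.aemeasurable, ?_⟩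
    convert! h.tendsto using 2
    refine congrArg 𝓝 (Subtype.ext ?_)
    change (μ : Measure Uinf).map infToBar = ((μ : Measure Uinf).map projHomeo).map limToBar
    rw [Measure.map_map continuous_limToBar.measurable projHomeo.continuous.measurable]
    congr 1
    funext x
    exact congrArg infToBar (projHomeo.symm_apply_apply x).symm
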